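/- Let $M$ be a smooth (Hausdorff, $\sigma$-compact, finite-dimensional) manifold and let $(\mathcal A,\rho,[\cdot,\cdot])$ be a Lie algebroid over $M$, i.e. a smooth finite-rank real vector bundle $\mathcal A\to M$ with a Lie bracket on $\Gamma(\mathcal A)$ and a smooth bundle map $\rho:\mathcal A\to TM$ such that $\rho([S,T])=[\rho(S),\rho(T)]$ and $[S,fT]=f[S,T]+(\rho(S)\cdot f)\,T$. Let $(\omega,J,g)$ be a compatible triple on $\mathcal A$: $\omega$ is a closed ($d^{\mathcal A}\omega=0$) nondegenerate 2-form on $\mathcal A$, $J$ is a smooth bundle endomorphism of $\mathcal A$ with $J^2=-\mathrm{id}$, and $g$ is a Riemannian metric on $\mathcal A$, with $g(JS,JT)=g(S,T)$ and $\omega(S,T)=g(S,JT)$. For $f\in C^\infty(M)$ let $a_f\in\Gamma(\mathcal A)$ be its Hamiltonian section, the unique section with $df(\rho(b))=\omega(a_f,b)$ for all $b$, and put $\{f,h\}:=\omega(a_f,a_h)$. For $p\in M$ let $L_p=\ker\rho_p$, let $V^\omega$ denote the $\omega$-orthogonal complement of a subspace $V\subseteq\mathcal A_p$, and set $L^1_p=L_p\cap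 L_p^\omega$, $E^1_p=J(L^1_p)$, $E^2_p=(L_p+E^1_p)^\omega$. The symplectic generalized distribution is $\Lambda_p=\rho(E^2_p+L^1_p)\subseteq T_pM$. Let $x\in M$ and let $\mathcal O_x\subseteq M$ be an integral submanifold of $\Lambda$ through $x$, that is, an injectively immersed smooth submanifold containing $x$ with $T_y\mathcal O_x=\Lambda_y$ for every $y\in\mathcal O_x$ (for instance the maximal connected one). If $f\in C^\infty(M)$ is constant on $\mathcal O_x$, then $$\{f,h\}(y)=0\qquad\text{for every } h\in C^\infty(M)\text{ and every } y\in\mathcal O_x .$$ -/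

import Mathlib

open Set Bundle Manifold
open scoped Manifold ContDiff

noncomputable section

section LieAlgebroid

variable {E : Type*} [NormedAddCommGroup E] [NormedSpace ℝ E] [FiniteDimensional ℝ E]
  {H : Type*} [TopologicalSpace H] (I : ModelWithCorners ℝ E H)
  {M : Type*} [TopologicalSpace M] [ChartedSpace H M] [IsManifold I ∞ M]
  (F : Type*) [NormedAddCommGroup F] [NormedSpace ℝ F] [FiniteDimensional ℝ F]
  (A : M → Type*) [TopologicalSpace (TotalSpace F A)]
  [∀ x, TopologicalSpace (A x)] [∀ x, AddCommGroup (A x)] [∀ x, Module ℝ (A x)]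
  [∀ x, IsTopologicalAddGroup (A x)] [∀ x, ContinuousSMul ℝ (A x)]
  [FiberBundle F A] [VectorBundle ℝ F A] [ContMDiffVectorBundle ∞ F A I]

/-- The derivative of a real function `φ` at `x` in the direction `v`. -/
def dirDeriv (φ : M → ℝ) (x : M) (v : TangentSpace I x) : ℝ := mfderiv I 𝓘(ℝ, ℝ) φ x v

/-- The product `f • s` of a smooth function and a smooth section. -/
def smulSection {I : ModelWithCorners ℝ E H} {F : Type*} [NormedAddCommGroup F] [NormedSpace ℝ F]
    {A : M → Type*} [TopologicalSpace (TotalSpace F A)]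
    [∀ x, TopologicalSpace (A x)] [∀ x, AddCommGroup (A x)] [∀ x, Module ℝ (A x)]
    [FiberBundle F A] [VectorBundle ℝ F A]
    (f : C^∞⟮I, M; 𝓘(ℝ, ℝ), ℝ⟯) (s : Cₛ^∞⟮I; F, A⟯) : Cₛ^∞⟮I; F, A⟯ :=
  ⟨fun x => f x • s x, f.contMDiff.smul_section s.contMDiff⟩

/-- A Lie algebroid structure on the smooth vector bundle `A → M` (with model fibre `F`): a smooth
bundle map `ρ : A → TM` (the anchor) and a Lie bracket on the real vector space `Γ(A)` of smooth
sections such that `ρ` is a homomorphism into vector fields and the Leibniz identity holds. -/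
structure LieAlgebroid where
  /-- the anchor map -/
  anchor (x : M) : A x →L[ℝ] TangentSpace I x
  contMDiff_anchor : ContMDiff I (I.prod 𝓘(ℝ, F →L[ℝ] E)) ∞
    (fun x => TotalSpace.mk' (F →L[ℝ] E) (E := fun x : M => A x →L[ℝ] TangentSpace I x)
      x (anchor x))
  /-- the bracket of sections, as an `ℝ`-bilinear map -/
  bracket : Cₛ^∞⟮I; F, A⟯ →ₗ[ℝ] Cₛ^∞⟮I; F, A⟯ →ₗ[ℝ] Cₛ^∞⟮I; F, A⟯
  bracket_self (s : Cₛ^∞⟮I; F, A⟯) : bracket s s = 0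
  jacobi (s t u : Cₛ^∞⟮I; F, A⟯) :
    bracket s (bracket t u) + bracket t (bracket u s) + bracket u (bracket s t) = 0
  anchor_bracket (s t : Cₛ^∞⟮I; F, A⟯) (x : M) :
    anchor x (bracket s t x) =
      VectorField.mlieBracket I (fun y => anchor y (s y)) (fun y => anchor y (t y)) x
  leibniz (s t : Cₛ^∞⟮I; F, A⟯) (f : C^∞⟮I, M; 𝓘(ℝ, ℝ), ℝ⟯) (x : M) :
    bracket s (smulSection f t) x =
      f x • bracket s t x + dirDeriv I f x (anchor x (s x)) • t x

variable {I F A}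

namespace LieAlgebroid

variable (𝒜 : LieAlgebroid I F A)

/-- The derivative `ρ(s)·φ` of a real function along the anchor of a section. -/
def anchorDeriv (s : Cₛ^∞⟮I; F, A⟯) (φ : M → ℝ) (x : M) : ℝ :=
  dirDeriv I φ x (𝒜.anchor x (s x))

/-- The Lie algebroid exterior derivative `dΩ(s₀, s₁, s₂)` of a 2-form `Ω`. -/
def extDerivTwo (Ω : ∀ x, A x →L[ℝ] A x →L[ℝ] ℝ) (s₀ s₁ s₂ : Cₛ^∞⟮I; F, A⟯) (x : M) : ℝ :=
  𝒜.anchorDeriv s₀ (fun y => Ω y (s₁ y) (s₂ y)) x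
    - 𝒜.anchorDeriv s₁ (fun y => Ω y (s₀ y) (s₂ y)) x
    + 𝒜.anchorDeriv s₂ (fun y => Ω y (s₀ y) (s₁ y)) x
    - Ω x (𝒜.bracket s₀ s₁ x) (s₂ x)
    + Ω x (𝒜.bracket s₀ s₂ x) (s₁ x)
    - Ω x (𝒜.bracket s₁ s₂ x) (s₀ x)

/-- The isotropy `L_x = ker ρ_x`. -/
def isotropy (x : M) : Submodule ℝ (A x) := LinearMap.ker (𝒜.anchor x : A x →ₗ[ℝ] TangentSpace I x)

/-- A symplectic form on a Lie algebroid: a smooth, closed, nondegenerate 2-form. -/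
structure SymplecticForm where
  /-- the underlying family of bilinear forms -/
  form (x : M) : A x →L[ℝ] A x →L[ℝ] ℝ
  contMDiff_form : ContMDiff I (I.prod 𝓘(ℝ, F →L[ℝ] F →L[ℝ] ℝ)) ∞
    (fun x => TotalSpace.mk' (F →L[ℝ] F →L[ℝ] ℝ) (E := fun x : M => A x →L[ℝ] A x →L[ℝ] ℝ)
      x (form x))
  form_self (x : M) (v : A x) : form x v v = 0
  nondegenerate (x : M) (v : A x) (hv : ∀ w : A x, form x v w = 0) : v = 0
  closed (s₀ s₁ s₂ : Cₛ^∞⟮I; F, A⟯) (x : M) : 𝒜.extDerivTwo form s₀ s₁ s₂ x = 0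

end LieAlgebroid

variable (I F A) in
/-- An almost complex structure on `A`: a smooth bundle endomorphism `J` with `J² = -id`. -/
structure AlmostComplexStructure where
  /-- the underlying family of endomorphisms -/
  J (x : M) : A x →L[ℝ] A x
  contMDiff_J : ContMDiff I (I.prod 𝓘(ℝ, F →L[ℝ] F)) ∞
    (fun x => TotalSpace.mk' (F →L[ℝ] F) (E := fun x : M => A x →L[ℝ] A x) x (J x))
  J_J (x : M) (v : A x) : J x (J x v) = -v

namespace LieAlgebroid

namespace SymplecticForm

variable {𝒜 : LieAlgebroid I F A} (Ω : 𝒜.SymplecticForm)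

/-- The symplectic complement `V^Ω` of a subspace `V` of `A_x`. -/
def complement (x : M) (V : Submodule ℝ (A x)) : Submodule ℝ (A x) where
  carrier := {a | ∀ v ∈ V, Ω.form x a v = 0}
  add_mem' ha hb v hv := by simp [ha v hv, hb v hv]
  zero_mem' v _ := by simp
  smul_mem' c a ha v hv := by simp [ha v hv]


theorem isInvertible_form (x : M) : (Ω.form x).IsInvertible := by
  let c : A x ≃L[ℝ] F := (trivializationAt F A x).continuousLinearEquivAt ℝ x
    (FiberBundle.mem_baseSet_trivializationAt' x)
  have : T2Space (A x) := c.toHomeomorph.symm.t2Space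
  have : FiniteDimensional ℝ (A x) := c.symm.toLinearEquiv.finiteDimensional
  let d : (A x →ₗ[ℝ] ℝ) ≃ₗ[ℝ] (A x →L[ℝ] ℝ) := LinearMap.toContinuousLinearMap
  have : FiniteDimensional ℝ (A x →L[ℝ] ℝ) := d.finiteDimensional
  have hinj : Function.Injective (Ω.form x : A x →ₗ[ℝ] (A x →L[ℝ] ℝ)) := by
    rw [← LinearMap.ker_eq_bot, LinearMap.ker_eq_bot']
    intro v hv
    exact Ω.nondegenerate x v fun w => DFunLike.congr_fun hv w
  have hdim : Module.finrank ℝ (A x) = Module.finrank ℝ (A x →L[ℝ] ℝ) := by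
    rw [← d.finrank_eq]; exact Subspace.dual_finrank_eq.symm
  let e := LinearEquiv.ofInjectiveOfFinrankEq (Ω.form x : A x →ₗ[ℝ] (A x →L[ℝ] ℝ)) hinj hdim
  refine ⟨e.toContinuousLinearEquiv, ?_⟩
  ext v w
  rfl

/-- The 1-form `df ∘ ρ` on `A` is smooth. -/
theorem contMDiff_differential_comp_anchor (𝒜 : LieAlgebroid I F A)
    (f : C^∞⟮I, M; 𝓘(ℝ, ℝ), ℝ⟯) :
    ContMDiff I (I.prod 𝓘(ℝ, F →L[ℝ] ℝ)) ∞
      (fun x => TotalSpace.mk' (F →L[ℝ] ℝ) (E := fun x : M => A x →L[ℝ] Bundle.Trivial M ℝ x)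
        x ((show TangentSpace I x →L[ℝ] ℝ from mfderiv I 𝓘(ℝ, ℝ) f x).comp (𝒜.anchor x))) := by
  intro x₀
  rw [contMDiffAt_hom_bundle]
  refine ⟨contMDiffAt_id, ?_⟩
  have h1 := ((contMDiffAt_hom_bundle _).1 (𝒜.contMDiff_anchor x₀)).2
  have h2 := (f.contMDiff x₀).mfderiv_const (m := ∞) (by simp)
  refine (h2.clm_comp h1).congr_of_eventuallyEq ?_
  have hT : (trivializationAt E (TangentSpace I) x₀).baseSet ∈ nhds x₀ :=
    (trivializationAt _ _ _).open_baseSet.mem_nhds (FiberBundle.mem_baseSet_trivializationAt' _)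
  filter_upwards [hT] with x hx
  ext v
  simp [inTangentCoordinates, ContinuousLinearMap.inCoordinates]
  have h := (trivializationAt E (TangentSpace I) x₀).symmL_continuousLinearMapAt (R := ℝ) hx
    (𝒜.anchor x ((trivializationAt F A x₀).symmL ℝ x v))
  exact (congrArg (fun w => (mfderiv I 𝓘(ℝ, ℝ) f x) w) h).symm

/-- Existence and uniqueness of Hamiltonian sections. -/
theorem existsUnique_hamiltonianSection (f : C^∞⟮I, M; 𝓘(ℝ, ℝ), ℝ⟯) :
    ∃! a : Cₛ^∞⟮I; F, A⟯, ∀ (x : M) (v : A x),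
      dirDeriv I f x (𝒜.anchor x v) = Ω.form x (a x) v := by
  let ψ : ∀ x, (A x →L[ℝ] Bundle.Trivial M ℝ x) →L[ℝ] A x := fun x => (Ω.form x).inverse
  let α : ∀ x, A x →L[ℝ] Bundle.Trivial M ℝ x := fun x =>
    (show TangentSpace I x →L[ℝ] ℝ from mfderiv I 𝓘(ℝ, ℝ) f x).comp (𝒜.anchor x)
  have hψ : ContMDiff I (I.prod 𝓘(ℝ, (F →L[ℝ] ℝ) →L[ℝ] F)) ∞
      (fun x => TotalSpace.mk' ((F →L[ℝ] ℝ) →L[ℝ] F)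
        (E := fun x : M => (A x →L[ℝ] Bundle.Trivial M ℝ x) →L[ℝ] A x) x (ψ x)) := by
    intro x₀
    rw [contMDiffAt_hom_bundle]
    refine ⟨contMDiffAt_id, ?_⟩
    have h1 := ((contMDiffAt_hom_bundle _).1 (Ω.contMDiff_form x₀)).2
    have hA : (trivializationAt F A x₀).baseSet ∈ nhds x₀ :=
      (trivializationAt _ _ _).open_baseSet.mem_nhds (FiberBundle.mem_baseSet_trivializationAt' _)
    have hB : (trivializationAt (F →L[ℝ] ℝ) (fun x : M => A x →L[ℝ] Bundle.Trivial M ℝ x)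
        x₀).baseSet ∈ nhds x₀ :=
      (trivializationAt _ _ _).open_baseSet.mem_nhds (FiberBundle.mem_baseSet_trivializationAt' _)
    have h2 : ContMDiffAt I 𝓘(ℝ, (F →L[ℝ] ℝ) →L[ℝ] F) ∞
        (ContinuousLinearMap.inverse ∘ fun x => ContinuousLinearMap.inCoordinates F A (F →L[ℝ] ℝ)
          (fun x : M => A x →L[ℝ] Bundle.Trivial M ℝ x) x₀ x x₀ x (Ω.form x)) x₀ := by
      refine ContMDiffAt.comp x₀ (ContDiffAt.contMDiffAt ?_) h1
      apply ContinuousLinearMap.IsInvertible.contDiffAt_map_inverse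
      rw [ContinuousLinearMap.inCoordinates_eq (mem_of_mem_nhds hA) (mem_of_mem_nhds hB)]
      exact ContinuousLinearMap.isInvertible_equiv.comp
        ((Ω.isInvertible_form x₀).comp ContinuousLinearMap.isInvertible_equiv)
    refine h2.congr_of_eventuallyEq ?_
    filter_upwards [hA, hB] with x hx hx'
    rw [Function.comp_apply, ContinuousLinearMap.inCoordinates_eq hx hx',
      ContinuousLinearMap.inCoordinates_eq hx' hx]
    simp [ψ]
    rfl
  refine ⟨⟨fun x => ψ x (α x), hψ.clm_bundle_apply
    (contMDiff_differential_comp_anchor 𝒜 f)⟩, fun x v => ?_, fun b hb => ?_⟩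
  swap
  · ext x
    obtain ⟨e, he⟩ := Ω.isInvertible_form x
    have h : α x = e (b x) := by
      ext v
      have := hb x v
      rw [← he] at this
      exact this
    change b x = ψ x (α x)
    simp [ψ, ← he, h]
  have h : Ω.form x (ψ x (α x)) = α x := by
    obtain ⟨e, he⟩ := Ω.isInvertible_form x
    simp [ψ, ← he]
  exact (DFunLike.congr_fun h v).symm

/-- The Hamiltonian section of `f`: the (unique) smooth section `a_f` of `A` with
`df(ρ(v)) = Ω(a_f, v)` for all `v`. -/
def hamiltonianSection (f : C^∞⟮I, M; 𝓘(ℝ, ℝ), ℝ⟯) : Cₛ^∞⟮I; F, A⟯ :=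
  (Ω.existsUnique_hamiltonianSection f).exists.choose

/-- The Poisson bracket `{f, g} = Ω(a_f, a_g)`. -/
def poissonBracket (f g : C^∞⟮I, M; 𝓘(ℝ, ℝ), ℝ⟯) (x : M) : ℝ :=
  Ω.form x (Ω.hamiltonianSection f x) (Ω.hamiltonianSection g x)

end SymplecticForm

/-- A compatible triple `(Ω, J, g)`: an almost complex structure `J` and a Riemannian metric `g` on
`A` with `g(Jv, Jw) = g(v, w)` and `Ω(v, w) = g(v, Jw)`. -/
structure CompatibleTriple (𝒜 : LieAlgebroid I F A) where
  /-- the symplectic form -/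
  sympl : 𝒜.SymplecticForm
  /-- the almost complex structure -/
  cplx : AlmostComplexStructure I F A
  /-- the Riemannian metric -/
  metric : ContMDiffRiemannianMetric I ∞ F A
  metric_J_J (x : M) (v w : A x) :
    metric.inner x (cplx.J x v) (cplx.J x w) = metric.inner x v w
  form_eq (x : M) (v w : A x) : sympl.form x v w = metric.inner x v (cplx.J x w)

namespace CompatibleTriple

variable {𝒜 : LieAlgebroid I F A} (T : 𝒜.CompatibleTriple)

/-- `L¹ = L ∩ L^Ω`. -/
def LOne (x : M) : Submodule ℝ (A x) := 𝒜.isotropy x ⊓ T.sympl.complement x (𝒜.isotropy x)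

/-- `E¹ = J(L¹)`. -/
def EOne (x : M) : Submodule ℝ (A x) := (T.LOne x).map (T.cplx.J x : A x →ₗ[ℝ] A x)

/-- `E² = (L + E¹)^Ω`. -/
def ETwo (x : M) : Submodule ℝ (A x) := T.sympl.complement x (𝒜.isotropy x ⊔ T.EOne x)

/-- The symplectic generalized distribution `Λ = ρ(E² + L¹)` on `M`. -/
def distribution (x : M) : Submodule ℝ (TangentSpace I x) :=
  (T.ETwo x ⊔ T.LOne x).map (𝒜.anchor x : A x →ₗ[ℝ] TangentSpace I x)

end CompatibleTriple

end LieAlgebroid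

/-- The injective immersion `ι : N → M` presents its image `O = ι(N)` (with the manifold structure
of `N`) as an integral submanifold of the generalized distribution `Λ`: `T_yO = Λ_y` at every
point `y` of `O`. Neither connectedness nor maximality is asked for, so the maximal connected integral
submanifolds (the leaves of `Λ`) are included. -/
structure IsIntegralSubmanifold {E' : Type*} [NormedAddCommGroup E'] [NormedSpace ℝ E']
    {H' : Type*} [TopologicalSpace H'] (I' : ModelWithCorners ℝ E' H')
    {N : Type*} [TopologicalSpace N] [ChartedSpace H' N]
    (Λ : ∀ x : M, Submodule ℝ (TangentSpace I x)) (ι : N → M) : Prop where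
  contMDiff : ContMDiff I' I ∞ ι
  injective : Function.Injective ι
  injective_mfderiv (q : N) : Function.Injective (mfderiv I' I ι q)
  range_mfderiv (q : N) :
    LinearMap.range (mfderiv I' I ι q : TangentSpace I' q →ₗ[ℝ] TangentSpace I (ι q)) = Λ (ι q)

end LieAlgebroid

end

/-!
Only the tangent space at a single point matters. If `df` vanishes on `Λ = ρ(E² + L¹)`, then the
Hamiltonian section `a_f` lies in `(E²)^Ω = L + J(L¹)`, and it always lies in `L^Ω`. Since `Ω` tames
`J`, these two spaces meet only in `L¹`: pairing `l + Jm ∈ L^Ω` with `m ∈ L¹` gives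
`Ω(m, Jm) = 0`, hence `m = 0`. So `a_f ∈ L`, which is `Ω`-orthogonal to every Hamiltonian section.
-/

section BilinearForm

variable {R V : Type*} [CommRing R] [AddCommGroup V] [Module R V]

theorem sup_map_inf_orthogonal_inf_orthogonal {B : LinearMap.BilinForm R V} (hB : B.IsRefl)
    {J : V →ₗ[R] V} (hJ : ∀ v, B v (J v) = 0 → v = 0) (L : Submodule R V) :
    (L ⊔ (L ⊓ B.orthogonal L).map J) ⊓ B.orthogonal L = L ⊓ B.orthogonal L := by
  refine le_antisymm (le_inf ?_ inf_le_right) (inf_le_inf_right _ le_sup_left)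
  rintro _ ⟨hsup, horth⟩
  obtain ⟨l, hl, _, ⟨m, ⟨hmL, hm_orth⟩, rfl⟩, rfl⟩ := Submodule.mem_sup.1 hsup
  have hml : B m l = 0 := hB l m (hm_orth l hl)
  have hmJm : B m (J m) = 0 := by simpa only [map_add, hml, zero_add] using horth m hmL
  simpa only [hJ m hmJm, map_zero, add_zero] using hl

end BilinearForm

section ChainRule

variable {𝕜 : Type*} [NontriviallyNormedField 𝕜]
  {E : Type*} [NormedAddCommGroup E] [NormedSpace 𝕜 E]
  {H : Type*} [TopologicalSpace H] {I : ModelWithCorners 𝕜 E H}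
  {M : Type*} [TopologicalSpace M] [ChartedSpace H M]
  {E' : Type*} [NormedAddCommGroup E'] [NormedSpace 𝕜 E']
  {H' : Type*} [TopologicalSpace H'] {I' : ModelWithCorners 𝕜 E' H'}
  {M' : Type*} [TopologicalSpace M'] [ChartedSpace H' M']
  {E'' : Type*} [NormedAddCommGroup E''] [NormedSpace 𝕜 E'']
  {H'' : Type*} [TopologicalSpace H''] {I'' : ModelWithCorners 𝕜 E'' H''}
  {M'' : Type*} [TopologicalSpace M''] [ChartedSpace H'' M'']

theorem mfderiv_apply_eq_zero_of_mem_range_mfderiv {g : M' → M''} {f : M → M'} {x : M}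
    (hg : MDifferentiableAt I' I'' g (f x)) (hf : MDifferentiableAt I I' f x)
    (hgf : mfderiv I I'' (g ∘ f) x = 0) {v : TangentSpace I' (f x)}
    (hv : v ∈ (mfderiv I I' f x).range) :
    mfderiv I' I'' g (f x) v = 0 := by
  obtain ⟨w, rfl⟩ := hv
  rw [mfderiv_comp x hg hf] at hgf
  exact DFunLike.congr_fun hgf w

end ChainRule

section LieAlgebroid

variable {E : Type*} [NormedAddCommGroup E] [NormedSpace ℝ E]
  {H : Type*} [TopologicalSpace H] {I : ModelWithCorners ℝ E H}
  {M : Type*} [TopologicalSpace M] [ChartedSpace H M] [IsManifold I ∞ M]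
  {F : Type*} [NormedAddCommGroup F] [NormedSpace ℝ F]
  {A : M → Type*} [TopologicalSpace (TotalSpace F A)]
  [∀ x, TopologicalSpace (A x)] [∀ x, AddCommGroup (A x)] [∀ x, Module ℝ (A x)]
  [FiberBundle F A] [VectorBundle ℝ F A] {𝒜 : LieAlgebroid I F A}

namespace LieAlgebroid

namespace SymplecticForm

variable (Ω : 𝒜.SymplecticForm) (x : M)

theorem isAlt_form : (Ω.form x).toBilinForm.IsAlt := Ω.form_self x

theorem nondegenerate_form : (Ω.form x).toBilinForm.Nondegenerate :=
  (Ω.isAlt_form x).isRefl.nondegenerate_iff_separatingLeft.2 (Ω.nondegenerate x)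

theorem complement_eq_orthogonal (W : Submodule ℝ (A x)) :
    Ω.complement x W = (Ω.form x).toBilinForm.orthogonal W := by
  ext a
  exact forall₂_congr fun _ _ => (Ω.isAlt_form x).isRefl.eq_iff

theorem complement_complement [FiniteDimensional ℝ F] (W : Submodule ℝ (A x)) :
    Ω.complement x (Ω.complement x W) = W := by
  have : FiniteDimensional ℝ (A x) := VectorBundle.finiteDimensional ℝ F A x
  rw [complement_eq_orthogonal, complement_eq_orthogonal]
  exact LinearMap.BilinForm.orthogonal_orthogonal (Ω.nondegenerate_form x)
    (Ω.isAlt_form x).isRefl W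

end SymplecticForm

end LieAlgebroid

variable [∀ x, IsTopologicalAddGroup (A x)] [∀ x, ContinuousSMul ℝ (A x)]

namespace LieAlgebroid

namespace CompatibleTriple

variable (T : 𝒜.CompatibleTriple) (x : M)

theorem form_J_self (v : A x) : T.sympl.form x v (T.cplx.J x v) = -T.metric.inner x v v := by
  rw [T.form_eq, T.cplx.J_J, map_neg]

theorem eq_zero_of_form_J_self_eq_zero {v : A x} (hv : T.sympl.form x v (T.cplx.J x v) = 0) :
    v = 0 := by
  by_contra hne
  rw [form_J_self, neg_eq_zero] at hv
  exact (T.metric.pos x v hne).ne' hv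

theorem isotropy_sup_EOne_inf_complement_isotropy :
    (𝒜.isotropy x ⊔ T.EOne x) ⊓ T.sympl.complement x (𝒜.isotropy x) = T.LOne x := by
  rw [EOne, LOne, SymplecticForm.complement_eq_orthogonal]
  exact sup_map_inf_orthogonal_inf_orthogonal (T.sympl.isAlt_form x).isRefl
    (fun _ => T.eq_zero_of_form_J_self_eq_zero x) _

theorem complement_ETwo_inf_complement_isotropy [FiniteDimensional ℝ F] :
    T.sympl.complement x (T.ETwo x) ⊓ T.sympl.complement x (𝒜.isotropy x) = T.LOne x := by
  rw [ETwo, SymplecticForm.complement_complement, isotropy_sup_EOne_inf_complement_isotropy]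

end CompatibleTriple

end LieAlgebroid

variable [FiniteDimensional ℝ E] [FiniteDimensional ℝ F] [ContMDiffVectorBundle ∞ F A I]

namespace LieAlgebroid

namespace SymplecticForm

variable (Ω : 𝒜.SymplecticForm) (f g : C^∞⟮I, M; 𝓘(ℝ, ℝ), ℝ⟯) {x : M}

theorem form_hamiltonianSection (v : A x) :
    Ω.form x (Ω.hamiltonianSection f x) v = dirDeriv I f x (𝒜.anchor x v) :=
  ((Ω.existsUnique_hamiltonianSection f).exists.choose_spec x v).symm

theorem hamiltonianSection_mem_complement_iff {W : Submodule ℝ (A x)} :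
    Ω.hamiltonianSection f x ∈ Ω.complement x W ↔
      ∀ v ∈ W, dirDeriv I f x (𝒜.anchor x v) = 0 :=
  forall₂_congr fun v _ => by rw [form_hamiltonianSection]

theorem hamiltonianSection_mem_complement_isotropy :
    Ω.hamiltonianSection f x ∈ Ω.complement x (𝒜.isotropy x) := by
  refine (Ω.hamiltonianSection_mem_complement_iff f).2 fun v hv => ?_
  rw [show 𝒜.anchor x v = 0 from hv]
  exact map_zero (mfderiv I 𝓘(ℝ, ℝ) f x)

variable {f} in
theorem poissonBracket_eq_zero_of_mem_isotropy (hf : Ω.hamiltonianSection f x ∈ 𝒜.isotropy x) :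
    Ω.poissonBracket f g x = 0 :=
  (Ω.isAlt_form x).isRefl _ _ (Ω.hamiltonianSection_mem_complement_isotropy g _ hf)

end SymplecticForm

namespace CompatibleTriple

variable (T : 𝒜.CompatibleTriple) {f : C^∞⟮I, M; 𝓘(ℝ, ℝ), ℝ⟯} {x : M}

theorem hamiltonianSection_mem_LOne (hf : ∀ v ∈ T.distribution x, dirDeriv I f x v = 0) :
    T.sympl.hamiltonianSection f x ∈ T.LOne x := by
  rw [← complement_ETwo_inf_complement_isotropy]
  refine ⟨(T.sympl.hamiltonianSection_mem_complement_iff f).2 fun v hv => ?_,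
    T.sympl.hamiltonianSection_mem_complement_isotropy f⟩
  exact hf _ (Submodule.mem_map_of_mem (Submodule.mem_sup_left hv))

theorem poissonBracket_eq_zero_of_dirDeriv_eq_zero
    (hf : ∀ v ∈ T.distribution x, dirDeriv I f x v = 0) (g : C^∞⟮I, M; 𝓘(ℝ, ℝ), ℝ⟯) :
    T.sympl.poissonBracket f g x = 0 :=
  T.sympl.poissonBracket_eq_zero_of_mem_isotropy g (T.hamiltonianSection_mem_LOne hf).1

end CompatibleTriple

end LieAlgebroid

theorem mainTheorem10_general (T : 𝒜.CompatibleTriple)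
    {E' : Type*} [NormedAddCommGroup E'] [NormedSpace ℝ E']
    {H' : Type*} [TopologicalSpace H'] {I' : ModelWithCorners ℝ E' H'}
    {N : Type*} [TopologicalSpace N] [ChartedSpace H' N]
    {ι : N → M} {q : N} (hι : MDifferentiableAt I' I ι q)
    (hΛ : T.distribution (ι q) ≤ (mfderiv I' I ι q).range)
    {f : C^∞⟮I, M; 𝓘(ℝ, ℝ), ℝ⟯} (hf : mfderiv I' 𝓘(ℝ, ℝ) (f ∘ ι) q = 0)
    (g : C^∞⟮I, M; 𝓘(ℝ, ℝ), ℝ⟯) :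
    T.sympl.poissonBracket f g (ι q) = 0 := by
  have hf_diff : MDifferentiableAt I 𝓘(ℝ, ℝ) f (ι q) := f.contMDiff.mdifferentiable (by simp) _
  exact T.poissonBracket_eq_zero_of_dirDeriv_eq_zero
    (fun _ hv => mfderiv_apply_eq_zero_of_mem_range_mfderiv hf_diff hι hf (hΛ hv)) g

end LieAlgebroid

theorem mainTheorem10
    {E : Type*} [NormedAddCommGroup E] [NormedSpace ℝ E] [FiniteDimensional ℝ E]
    {M : Type*} [TopologicalSpace M] [ChartedSpace E M] [IsManifold 𝓘(ℝ, E) ∞ M]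
    [T2Space M] [SigmaCompactSpace M]
    {F : Type*} [NormedAddCommGroup F] [NormedSpace ℝ F] [FiniteDimensional ℝ F]
    {A : M → Type*} [TopologicalSpace (TotalSpace F A)]
    [∀ x, TopologicalSpace (A x)] [∀ x, AddCommGroup (A x)] [∀ x, Module ℝ (A x)]
    [∀ x, IsTopologicalAddGroup (A x)] [∀ x, ContinuousSMul ℝ (A x)]
    [FiberBundle F A] [VectorBundle ℝ F A] [ContMDiffVectorBundle ∞ F A 𝓘(ℝ, E)]
    (𝒜 : LieAlgebroid 𝓘(ℝ, E) F A) (T : 𝒜.CompatibleTriple)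
    {E' : Type*} [NormedAddCommGroup E'] [NormedSpace ℝ E'] [FiniteDimensional ℝ E']
    {N : Type*} [TopologicalSpace N] [ChartedSpace E' N] [IsManifold 𝓘(ℝ, E') ∞ N]
    (ι : N → M) (hι : IsIntegralSubmanifold 𝓘(ℝ, E') T.distribution ι)
    (x : M) (hx : x ∈ Set.range ι)
    (f : C^∞⟮𝓘(ℝ, E), M; 𝓘(ℝ, ℝ), ℝ⟯)
    (hf : ∃ c : ℝ, ∀ y ∈ Set.range ι, f y = c) :
    ∀ (g : C^∞⟮𝓘(ℝ, E), M; 𝓘(ℝ, ℝ), ℝ⟯), ∀ y ∈ Set.range ι,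
      T.sympl.poissonBracket f g y = 0 := by
  obtain ⟨c, hc⟩ := hf
  rintro g _ ⟨q, rfl⟩
  have hconst : f ∘ ι = fun _ => c := funext fun p => hc _ ⟨p, rfl⟩
  have hcrit : mfderiv 𝓘(ℝ, E') 𝓘(ℝ, ℝ) (f ∘ ι) q = 0 := by rw [hconst, mfderiv_const]
  exact mainTheorem10_general T (hι.contMDiff.mdifferentiable (by simp) q)
    (hι.range_mfderiv q).ge hcrit g
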